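/- Let $\Sigma$ be a finite set of real $n\times n$ matrices. For $\Gamma\subseteq\Sigma$ put $N_\Gamma=\bigcap_{B\in\Gamma}\ker(I-B)$ and $R_\Gamma=\operatorname{span}\bigcup_{B\in\Gamma}\operatorname{range}(I-B)$ (so $N_\emptyset=\mathbb R^n$, $R_\emptyset=0$). Suppose that $\Sigma$ is CP, that is, for every sequence $B_1,B_2,\dots$ in $\Sigma$ both limits $\lim_m B_m\cdots B_1$ and $\lim_m B_1\cdots B_m$ exist, and $N_\Gamma\oplus R_\Gamma=\mathbb R^n$ for every $\Gamma\subseteq\Sigma$. Let $\mathcal L(\Sigma)$ be the set of all finite products of elements of $\Sigma$, including the empty product $I$. Let $R$ be a linearly ordered set and $A:R\to\Sigma$ any map. For $S\subseteq R$ the continuous product $M(S)$ is defined by recursion on $\#A(S)$. An interval of $S$ is a subset $T\subseteq S$ such that $a,b\in T$, $g\in S$, $a<g<b$ imply $g\in T$; it is complete if $A(T)=A(S)$ and incomplete otherwise. Let $I_S$ be the maximal number of pairwise disjoint complete intervals of $S$ ($I_S=\infty$ if there is no maximum). * If $S=\{s_1<\dots<s_k\}$ is finite, then $M(S)=A(s_1)\cdots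 A(s_k)$ (and $M(\emptyset)=I$). * If $I_S<\infty$ and $S=T_1\cup\dots\cup T_k$ with incomplete intervals $T_1<\dots<T_k$ of $S$ (all elements of $T_i$ precede all elements of $T_j$ for $i<j$), then $M(S)=M(T_1)\cdots M(T_k)$. * If $I_S=\infty$, then $M(S)$ is the matrix of the projection onto $N_{A(S)}$ along $R_{A(S)}$. Then, for every $S\subseteq R$, these rules determine exactly one matrix $M(S)$, and there is a sequence of matrices $M_i\in\mathcal L(\Sigma)$ such that $M_i\to M(S)$ as $i\to\infty$. -/

import Mathlib

open Filter Topology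

namespace ContProd

/-- Real square matrices of size `n`. -/
abbrev Mat (n : ℕ) : Type := Matrix (Fin n) (Fin n) ℝ

variable {n : ℕ}

/-- The set of all finite products of elements of `Γ`, the empty product `1` included. -/
def semigroup (Γ : Set (Mat n)) : Set (Mat n) :=
  {M | ∃ l : List (Mat n), (∀ B ∈ l, B ∈ Γ) ∧ l.prod = M}

/-- `B (m-1) * ⋯ * B 1 * B 0`. -/
def leftProd (B : ℕ → Mat n) : ℕ → Mat n
  | 0 => 1
  | m + 1 => B m * leftProd B m

/-- `B 0 * B 1 * ⋯ * B (m-1)`. -/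
def rightProd (B : ℕ → Mat n) : ℕ → Mat n
  | 0 => 1
  | m + 1 => rightProd B m * B m

/-- Left convergent products. -/
def IsLCP (Γ : Set (Mat n)) : Prop :=
  ∀ B : ℕ → Mat n, (∀ i, B i ∈ Γ) → ∃ L : Mat n, Tendsto (leftProd B) atTop (𝓝 L)

/-- Right convergent products. -/
def IsRCP (Γ : Set (Mat n)) : Prop :=
  ∀ B : ℕ → Mat n, (∀ i, B i ∈ Γ) → ∃ L : Mat n, Tendsto (rightProd B) atTop (𝓝 L)

/-- The intersection of the null spaces of `1 - B`, for `B ∈ Γ`. -/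
noncomputable def nullSpace (Γ : Set (Mat n)) : Submodule ℝ (Fin n → ℝ) :=
  ⨅ B ∈ Γ, LinearMap.ker (Matrix.toLin' (1 - B))

/-- The span of the ranges of `1 - B`, for `B ∈ Γ`. -/
noncomputable def rangeSpace (Γ : Set (Mat n)) : Submodule ℝ (Fin n → ℝ) :=
  ⨆ B ∈ Γ, LinearMap.range (Matrix.toLin' (1 - B))

/-- Transversality: the two subspaces are complementary for every subfamily. -/
def IsTransversal (Γ : Set (Mat n)) : Prop :=
  ∀ Γ' ⊆ Γ, IsCompl (nullSpace Γ') (rangeSpace Γ')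

/-- The CP property. -/
structure IsCP (Γ : Set (Mat n)) : Prop where
  lcp : IsLCP Γ
  rcp : IsRCP Γ
  transversal : IsTransversal Γ

/-- `P` is the matrix of the projection onto `nullSpace Γ` along `rangeSpace Γ`. -/
def IsProjectionFor (Γ : Set (Mat n)) (P : Mat n) : Prop :=
  ∀ x : Fin n → ℝ, P.mulVec x ∈ nullSpace Γ ∧ x - P.mulVec x ∈ rangeSpace Γ

variable {R : Type*} [LinearOrder R]

/-- `T` is an interval (a subset without holes) of the linearly ordered set `S`. -/
def IsIntervalOf (S T : Set R) : Prop :=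
  T ⊆ S ∧ ∀ a ∈ T, ∀ b ∈ T, ∀ g ∈ S, a < g → g < b → g ∈ T

/-- `T` is an interval of `S` on which `A` takes all the values that it takes on `S`. -/
def IsComplete (A : R → Mat n) (S T : Set R) : Prop :=
  IsIntervalOf S T ∧ A '' T = A '' S

/-- The maximal number (possibly `⊤`) of disjoint complete intervals of `S`. -/
noncomputable def completeCount (A : R → Mat n) (S : Set R) : ℕ∞ :=
  ⨆ (F : Finset (Set R)) (_ : (∀ T ∈ F, IsComplete A S T) ∧
    (F : Set (Set R)).PairwiseDisjoint id), (F.card : ℕ∞)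

/-- `IsContProd A S M`: the matrix `M` is a value of the continuous product of `A` over `S`.
The recursion is on the number of different matrices `A r`, `r ∈ S`.
* For a finite set `S` it is the ordered product.
* If there is a bound on the number of disjoint complete intervals of `S`, then `S` is partitioned
  into finitely many adjacent disjoint incomplete intervals, over which the products involve fewer
  matrices, and these products are multiplied in order.
* If there is no such bound, it is the projection onto `nullSpace (A '' S)` along
  `rangeSpace (A '' S)`. -/
inductive IsContProd (A : R → Mat n) : Set R → Mat n → Prop
  | finite (l : List R) (hl : l.Pairwise (· < ·)) :
      IsContProd A {r | r ∈ l} (l.map A).prod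
  | partition (S : Set R) (hS : completeCount A S < ⊤) (k : ℕ) (T : Fin k → Set R)
      (hUnion : ⋃ i, T i = S)
      (hOrder : ∀ i j, i < j → ∀ a ∈ T i, ∀ b ∈ T j, a < b)
      (hIncomplete : ∀ i, A '' T i ≠ A '' S)
      (P : Fin k → Mat n) (hP : ∀ i, IsContProd A (T i) (P i)) :
      IsContProd A S (List.ofFn P).prod
  | projection (S : Set R) (hS : completeCount A S = ⊤) (P : Mat n)
      (hP : IsProjectionFor (A '' S) P) :
      IsContProd A S P

end ContProd

/-! Induction on the number `c` of values of `A` on `S` carries existence, uniqueness and the cut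
rule `M(X ∪ Y) = M(X) M(Y)` together (`IsDeterminedBelow`). The cut rule below `c` makes a product
over incomplete pieces independent of the partition: compare two partitions through their common
refinement (`IsAdditiveOn.prod_eq_prod`).

A partition exists whenever the count is finite and `S` is infinite. Otherwise `S` splits into two
complete parts, one again indivisible (`exists_cut`), and iterating yields arbitrarily many disjoint
complete intervals.

If the count is infinite, one side of any cut is complete with infinite count, so its value is the
projection `P` for `A '' S`. The other factor lies in the closed semigroup of `A '' S` and is
absorbed: `P * M = P` and `M * P = P`.

Approximation holds because the closed semigroup is a submonoid and contains `P`, a limit of left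
products (`exists_isProjectionFor`). -/

namespace ContProd

/-! ### Ordered products over finite ordered partitions -/

/-- Every element of `X` precedes every element of `Y`. -/
def Precedes {R : Type*} [LinearOrder R] (X Y : Set R) : Prop :=
  ∀ a ∈ X, ∀ b ∈ Y, a < b

/-- Regrouping needs no commutativity: if `b 0 ≠ 1`, all later `a j` are `1`, so no nontrivial
factor has to pass `b 0`. -/
theorem prod_ofFn_mul {G : Type*} [Monoid G] : ∀ (k : ℕ) (a b : Fin k → G),
    (∀ i j, i < j → b i = 1 ∨ a j = 1) →
      (List.ofFn fun i => a i * b i).prod = (List.ofFn a).prod * (List.ofFn b).prod := by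
  intro k
  induction k with
  | zero => intro a b _; simp
  | succ k ih =>
    intro a b h
    simp only [List.ofFn_succ, List.prod_cons]
    rw [ih (fun i => a i.succ) (fun i => b i.succ)
      (fun i j hij => h _ _ (Fin.succ_lt_succ_iff.2 hij))]
    by_cases hb : b 0 = 1
    · simp [hb, mul_assoc]
    · have ha : (fun i : Fin k => a i.succ) = fun _ => 1 :=
        funext fun i => (h 0 i.succ (Fin.succ_pos i)).resolve_left hb
      simp [ha, mul_assoc]

/-- `f` is multiplicative with respect to cuts of the sets in `D`. -/
structure IsAdditiveOn {R G : Type*} [LinearOrder R] [Monoid G] (D : Set (Set R))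
    (f : Set R → G) : Prop where
  empty : f ∅ = 1
  union : ∀ X Y : Set R, Precedes X Y → X ∪ Y ∈ D → f (X ∪ Y) = f X * f Y

/-- Extension of `f` through a partition `T`. -/
def partitionValue {R G : Type*} [Monoid G] {k : ℕ} (f : Set R → G) (T : Fin k → Set R)
    (X : Set R) : G :=
  (List.ofFn fun i => f (T i ∩ X)).prod

theorem partitionValue_self {R G : Type*} [Monoid G] {f : Set R → G} {k : ℕ}
    {T : Fin k → Set R} {S : Set R} (hU : ⋃ i, T i = S) :
    partitionValue f T S = (List.ofFn fun i => f (T i)).prod := by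
  unfold partitionValue
  congr 2
  funext i
  rw [Set.inter_eq_left.2 (hU ▸ Set.subset_iUnion T i)]

section Additive

variable {R G : Type*} [LinearOrder R] [Monoid G] {D : Set (Set R)} {f : Set R → G}

theorem IsAdditiveOn.iUnion (hf : IsAdditiveOn D f) (hD : IsLowerSet D) :
    ∀ (k : ℕ) (T : Fin k → Set R), (∀ i j, i < j → Precedes (T i) (T j)) → (⋃ i, T i) ∈ D →
      f (⋃ i, T i) = (List.ofFn fun i => f (T i)).prod := by
  intro k
  induction k with
  | zero => intro T _ _; simp [hf.empty]
  | succ k ih =>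
    intro T hT hU
    have hsplit : (⋃ i, T i) = T 0 ∪ ⋃ i : Fin k, T i.succ := by
      ext x; simp [Fin.exists_fin_succ]
    rw [hsplit] at hU ⊢
    rw [hf.union _ _ _ hU, List.ofFn_succ, List.prod_cons,
      ih (fun i => T i.succ) (fun i j hij => hT _ _ (Fin.succ_lt_succ_iff.2 hij))
        (hD Set.subset_union_right hU)]
    intro a ha b hb
    obtain ⟨i, hi⟩ := Set.mem_iUnion.1 hb
    exact hT 0 i.succ (Fin.succ_pos i) a ha b hi

/-- The domain grows from `D` to all sets, since only the traces on the `T i` matter. For `i < j`,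
`T i` cannot meet `Y` while `T j` meets `X`, which is the condition of `prod_ofFn_mul`. -/
theorem IsAdditiveOn.partitionValue (hf : IsAdditiveOn D f) (hD : IsLowerSet D) {k : ℕ}
    {T : Fin k → Set R} (hT : ∀ i j, i < j → Precedes (T i) (T j)) (hTD : ∀ i, T i ∈ D) :
    IsAdditiveOn Set.univ (partitionValue f T) where
  empty := by simp [ContProd.partitionValue, hf.empty]
  union X Y hXY _ := by
    unfold ContProd.partitionValue
    rw [← prod_ofFn_mul]
    · congr 2
      funext i
      rw [Set.inter_union_distrib_left]
      refine hf.union _ _ (fun a ha b hb => hXY a ha.2 b hb.2) (hD ?_ (hTD i))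
      rw [← Set.inter_union_distrib_left]
      exact Set.inter_subset_left
    · intro i j hij
      rcases (T i ∩ Y).eq_empty_or_nonempty with h | ⟨y, hy⟩
      · left; rw [h, hf.empty]
      · rcases (T j ∩ X).eq_empty_or_nonempty with h | ⟨x, hx⟩
        · right; rw [h, hf.empty]
        · exact absurd (hT i j hij y hy.1 x hx.1) (hXY x hx.2 y hy.2).asymm

theorem IsAdditiveOn.partitionValue_eq (hf : IsAdditiveOn D f) (hD : IsLowerSet D) {k : ℕ}
    {T : Fin k → Set R} (hT : ∀ i j, i < j → Precedes (T i) (T j)) {X : Set R} (hX : X ∈ D)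
    (hXT : X ⊆ ⋃ i, T i) : ContProd.partitionValue f T X = f X := by
  have hX' : (⋃ i, T i ∩ X) = X := by
    rw [← Set.iUnion_inter, Set.inter_eq_right.2 hXT]
  have := hf.iUnion hD k (fun i => T i ∩ X) (fun i j hij a ha b hb => hT i j hij a ha.1 b hb.1)
    (by rw [hX']; exact hX)
  rw [hX'] at this
  exact this.symm

/-- The extension of `f` through `T` is multiplicative along `T'` and agrees with `f` on each `T'
j`. -/
theorem IsAdditiveOn.prod_eq_prod (hf : IsAdditiveOn D f) (hD : IsLowerSet D) {k k' : ℕ}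
    {T : Fin k → Set R} {T' : Fin k' → Set R} (hT : ∀ i j, i < j → Precedes (T i) (T j))
    (hT' : ∀ i j, i < j → Precedes (T' i) (T' j)) (hTD : ∀ i, T i ∈ D) (hTD' : ∀ i, T' i ∈ D)
    (hU : ⋃ i, T i = ⋃ i, T' i) :
    (List.ofFn fun i => f (T i)).prod = (List.ofFn fun i => f (T' i)).prod := by
  rw [← partitionValue_self hU,
    (hf.partitionValue hD hT hTD).iUnion isLowerSet_univ k' T' hT' (Set.mem_univ _)]
  congr 2
  funext j
  exact hf.partitionValue_eq hD hT (hTD' j) (hU ▸ Set.subset_iUnion T' j)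

end Additive

variable {n : ℕ}

/-! ### The projections and the closure of the semigroup -/

theorem semigroup_eq_closure (Γ : Set (Mat n)) : semigroup Γ = Submonoid.closure Γ := by
  ext M
  constructor
  · rintro ⟨l, hl, rfl⟩
    exact Submonoid.list_prod_mem _ fun B hB => Submonoid.subset_closure (hl B hB)
  · exact fun h => Submonoid.exists_list_of_mem_closure h

/-- The topological closure of the semigroup generated by `Γ`, as a submonoid. -/
noncomputable def closedSemigroup (Γ : Set (Mat n)) : Submonoid (Mat n) :=
  (Submonoid.closure Γ).topologicalClosure

theorem closedSemigroup_mono {Γ Δ : Set (Mat n)} (h : Γ ⊆ Δ) :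
    closedSemigroup Γ ≤ closedSemigroup Δ :=
  closure_mono (Submonoid.closure_mono h)

theorem mem_closedSemigroup {Γ : Set (Mat n)} {B : Mat n} (h : B ∈ Γ) : B ∈ closedSemigroup Γ :=
  Submonoid.le_topologicalClosure _ (Submonoid.subset_closure h)

theorem closedSemigroup_le {Γ : Set (Mat n)} {H : Submonoid (Mat n)} (h : Γ ⊆ H)
    (hc : IsClosed (H : Set (Mat n))) : closedSemigroup Γ ≤ H :=
  Submonoid.topologicalClosure_minimal _ ((Submonoid.closure_le).2 h) hc

theorem mem_nullSpace {Γ : Set (Mat n)} {x : Fin n → ℝ} :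
    x ∈ nullSpace Γ ↔ ∀ B ∈ Γ, B.mulVec x = x := by
  simp only [nullSpace, Submodule.mem_iInf, LinearMap.mem_ker, Matrix.toLin'_apply,
    Matrix.sub_mulVec, Matrix.one_mulVec, sub_eq_zero]
  exact forall₂_congr fun _ _ => eq_comm

theorem sub_mulVec_mem_rangeSpace {Γ : Set (Mat n)} {B : Mat n} (hB : B ∈ Γ) (x : Fin n → ℝ) :
    x - B.mulVec x ∈ rangeSpace Γ := by
  have h : LinearMap.range (Matrix.toLin' (1 - B)) ≤ rangeSpace Γ := le_iSup₂_of_le B hB le_rfl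
  exact h ⟨x, by simp⟩

theorem rangeSpace_le {Γ : Set (Mat n)} {W : Submodule ℝ (Fin n → ℝ)}
    (h : ∀ B ∈ Γ, ∀ x, x - B.mulVec x ∈ W) : rangeSpace Γ ≤ W := by
  refine iSup₂_le fun B hB => ?_
  rintro _ ⟨x, rfl⟩
  simpa [Matrix.sub_mulVec] using h B hB x

theorem IsProjectionFor.unique {Γ : Set (Mat n)} (hΓ : IsCompl (nullSpace Γ) (rangeSpace Γ))
    {P Q : Mat n} (hP : IsProjectionFor Γ P) (hQ : IsProjectionFor Γ Q) : P = Q := by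
  refine Matrix.ext_of_mulVec_single fun i => ?_
  set x : Fin n → ℝ := Pi.single i 1
  have h1 := (nullSpace Γ).sub_mem (hP x).1 (hQ x).1
  have h2 : P.mulVec x - Q.mulVec x ∈ rangeSpace Γ := by
    have := (rangeSpace Γ).sub_mem (hQ x).2 (hP x).2
    rwa [sub_sub_sub_cancel_left] at this
  exact sub_eq_zero.1 (Submodule.disjoint_def.1 hΓ.disjoint _ h1 h2)

theorem IsProjectionFor.apply_eq_zero {Γ : Set (Mat n)}
    (hΓ : IsCompl (nullSpace Γ) (rangeSpace Γ)) {P : Mat n} (hP : IsProjectionFor Γ P)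
    {y : Fin n → ℝ} (hy : y ∈ rangeSpace Γ) : P.mulVec y = 0 := by
  refine Submodule.disjoint_def.1 hΓ.disjoint _ (hP y).1 ?_
  have := (rangeSpace Γ).sub_mem hy (hP y).2
  rwa [sub_sub_cancel] at this

/-- The solutions of `P * M = P` form a closed submonoid; it contains each generator `B` because `P`
kills the range of `1 - B`. -/
theorem IsProjectionFor.mul_eq {Γ : Set (Mat n)} (hΓ : IsCompl (nullSpace Γ) (rangeSpace Γ))
    {P : Mat n} (hP : IsProjectionFor Γ P) {M : Mat n} (hM : M ∈ closedSemigroup Γ) :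
    P * M = P := by
  let H : Submonoid (Mat n) :=
    { carrier := {M | P * M = P}
      one_mem' := mul_one P
      mul_mem' := fun {a b} ha hb => by
        simp only [Set.mem_ofPred_eq] at *
        rw [← mul_assoc, ha, hb] }
  have hH : IsClosed (H : Set (Mat n)) :=
    isClosed_eq (continuous_const.mul continuous_id) continuous_const
  refine closedSemigroup_le (H := H) (fun B hB => ?_) hH hM
  refine Matrix.ext_of_mulVec_single fun i => ?_
  have := hP.apply_eq_zero hΓ (sub_mulVec_mem_rangeSpace hB (Pi.single i 1))
  rw [Matrix.mulVec_sub, sub_eq_zero, Matrix.mulVec_mulVec] at this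
  exact this.symm

theorem IsProjectionFor.eq_mul {Γ : Set (Mat n)} {P : Mat n} (hP : IsProjectionFor Γ P)
    {M : Mat n} (hM : M ∈ closedSemigroup Γ) : M * P = P := by
  let H : Submonoid (Mat n) :=
    { carrier := {M | M * P = P}
      one_mem' := one_mul P
      mul_mem' := fun {a b} ha hb => by
        simp only [Set.mem_ofPred_eq] at *
        rw [mul_assoc, hb, ha] }
  have hH : IsClosed (H : Set (Mat n)) :=
    isClosed_eq (continuous_id.mul continuous_const) continuous_const
  refine closedSemigroup_le (H := H) (fun B hB => ?_) hH hM
  refine Matrix.ext_of_mulVec_single fun i => ?_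
  rw [← Matrix.mulVec_mulVec]
  exact mem_nullSpace.1 (hP _).1 B hB

theorem leftProd_mem_closure {Γ : Set (Mat n)} {B : ℕ → Mat n} (hB : ∀ i, B i ∈ Γ) (m : ℕ) :
    leftProd B m ∈ Submonoid.closure Γ := by
  induction m with
  | zero => exact one_mem _
  | succ m ih => exact mul_mem (Submonoid.subset_closure (hB m)) ih

theorem sub_leftProd_mulVec_mem {Γ : Set (Mat n)} {B : ℕ → Mat n} (hB : ∀ i, B i ∈ Γ) (m : ℕ)
    (x : Fin n → ℝ) : x - (leftProd B m).mulVec x ∈ rangeSpace Γ := by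
  induction m with
  | zero => simp [leftProd]
  | succ m ih =>
    have := (rangeSpace Γ).add_mem ih (sub_mulVec_mem_rangeSpace (hB m) ((leftProd B m).mulVec x))
    rwa [sub_add_sub_cancel, Matrix.mulVec_mulVec] at this

/-- The projection onto `nullSpace Γ` along `rangeSpace Γ` is a limit of left products in which
every element of `Γ` occurs infinitely often. -/
theorem exists_isProjectionFor {Γ : Set (Mat n)} (hc : Γ.Countable) (hL : IsLCP Γ) :
    ∃ P ∈ closedSemigroup Γ, IsProjectionFor Γ P := by
  rcases Γ.eq_empty_or_nonempty with rfl | hne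
  · exact ⟨1, one_mem _, fun x => ⟨mem_nullSpace.2 (by simp), by simp⟩⟩
  obtain ⟨g, rfl⟩ := hc.exists_eq_range hne
  -- Through the pairing function, `g i` occurs at every index `Nat.pair i j`.
  set B : ℕ → Mat n := fun m => g m.unpair.1
  have hB : ∀ i, B i ∈ Set.range g := fun i => ⟨_, rfl⟩
  obtain ⟨L, hlim⟩ := hL B hB
  have happ : ∀ x, Tendsto (fun m => (leftProd B m).mulVec x) atTop (𝓝 (L.mulVec x)) := fun x =>
    ((continuous_id.matrix_mulVec continuous_const).tendsto L).comp hlim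
  refine ⟨L, ?_, fun x => ⟨mem_nullSpace.2 ?_, ?_⟩⟩
  · exact mem_closure_of_tendsto hlim (.of_forall (leftProd_mem_closure hB))
  · rintro _ ⟨i, rfl⟩
    have hsub : Tendsto (fun j => Nat.pair i j) atTop atTop :=
      tendsto_atTop_mono (fun j => Nat.right_le_pair i j) tendsto_id
    -- Just after index `Nat.pair i j` the newest left factor is `g i`, so one subsequence tends
    -- both to `L x` and to `g i (L x)`.
    have h1 : Tendsto (fun j => (leftProd B (Nat.pair i j + 1)).mulVec x) atTop
        (𝓝 (L.mulVec x)) := (happ x).comp ((tendsto_add_atTop_nat 1).comp hsub)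
    have h2 : Tendsto (fun j => (leftProd B (Nat.pair i j + 1)).mulVec x) atTop
        (𝓝 ((g i).mulVec (L.mulVec x))) := by
      have h3 := ((Continuous.matrix_mulVec (A := fun _ => g i) continuous_const
        continuous_id).tendsto (L.mulVec x)).comp ((happ x).comp hsub)
      refine h3.congr fun j => ?_
      simp [leftProd, B, Matrix.mulVec_mulVec]
    exact tendsto_nhds_unique h2 h1
  · exact (Submodule.closed_of_finiteDimensional _).mem_of_tendsto
      (tendsto_const_nhds.sub (happ x)) (.of_forall fun m => sub_leftProd_mulVec_mem hB m x)

/-! ### Counting complete intervals -/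

section Count

variable {R : Type*} [LinearOrder R] {A : R → Mat n} {S X Y : Set R}

theorem completeCount_eq_top_iff : completeCount A S = ⊤ ↔
    ∀ k : ℕ, ∃ F : Finset (Set R), ((∀ T ∈ F, IsComplete A S T) ∧
      (F : Set (Set R)).PairwiseDisjoint id) ∧ k ≤ F.card := by
  constructor
  · intro h k
    by_contra! hk
    have : completeCount A S ≤ k := iSup₂_le fun F hF => by exact_mod_cast (hk F hF).le
    exact absurd (h ▸ this) (by simp)
  · intro h
    refine ENat.eq_top_iff_forall_ge.2 fun k => ?_
    obtain ⟨F, hF, hk⟩ := h k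
    exact le_iSup₂_of_le F hF (by exact_mod_cast hk)

theorem completeCount_lt_top_of_finite (hS : S.Finite) : completeCount A S < ⊤ := by
  rw [lt_top_iff_ne_top]
  intro h
  obtain ⟨F, hF, hk⟩ := completeCount_eq_top_iff.1 h (hS.powerset.toFinset.card + 1)
  have : F ⊆ hS.powerset.toFinset := fun T hT => by simpa using (hF.1 T hT).1.1
  have := Finset.card_le_card this
  omega

/-- With a single value, every singleton is a complete interval. -/
theorem completeCount_eq_top_of_infinite (hS : S.Infinite) (hA : (A '' S).Subsingleton) :
    completeCount A S = ⊤ := by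
  classical
  refine completeCount_eq_top_iff.2 fun k => ?_
  obtain ⟨t, ht, hk⟩ := hS.exists_subset_card_eq k
  refine ⟨t.image fun x => {x}, ⟨?_, ?_⟩, ?_⟩
  · intro T hT
    obtain ⟨x, hx, rfl⟩ := Finset.mem_image.1 hT
    refine ⟨⟨by simpa using ht hx, ?_⟩, ?_⟩
    · rintro a rfl b rfl g _ h1 h2
      exact absurd h1 h2.asymm
    · rw [Set.image_singleton]
      exact (hA.eq_singleton_of_mem ⟨x, ht hx, rfl⟩).symm
  · intro T hT T' hT' hne
    obtain ⟨x, -, rfl⟩ := Finset.mem_image.1 hT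
    obtain ⟨y, -, rfl⟩ := Finset.mem_image.1 hT'
    have hxy : x ≠ y := fun h => hne (by rw [h])
    simpa [Function.onFun] using hxy
  · rw [Finset.card_image_of_injective _ Set.singleton_injective, hk]

theorem IsComplete.trans (hX : IsComplete A S X) (hY : IsComplete A X Y) : IsComplete A S Y :=
  ⟨⟨hY.1.1.trans hX.1.1, fun a ha b hb g hg h1 h2 => hY.1.2 a ha b hb g
    (hX.1.2 a (hY.1.1 ha) b (hY.1.1 hb) g hg h1 h2) h1 h2⟩, hY.2.trans hX.2⟩

theorem IsComplete.completeCount_le (hX : IsComplete A S X) :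
    completeCount A X ≤ completeCount A S :=
  iSup₂_le fun F hF => le_iSup₂_of_le (f := fun (F : Finset (Set R)) _ => (F.card : ℕ∞)) F
    ⟨fun T hT => hX.trans (hF.1 T hT), hF.2⟩ le_rfl

theorem Precedes.isIntervalOf_left (h : Precedes X Y) : IsIntervalOf (X ∪ Y) X :=
  ⟨Set.subset_union_left, fun _ _ b hb g hg _ h2 =>
    hg.resolve_right fun hgY => (h b hb g hgY).asymm h2⟩

theorem Precedes.isIntervalOf_right (h : Precedes X Y) : IsIntervalOf (X ∪ Y) Y :=
  ⟨Set.subset_union_right, fun a ha _ _ g hg h1 _ =>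
    hg.resolve_left fun hgX => (h g hgX a ha).asymm h1⟩

/-- One of the two parts of a cut of a set with infinite count is complete with infinite count. -/
theorem Precedes.completeCount_eq_top (h : Precedes X Y) (hS : completeCount A (X ∪ Y) = ⊤) :
    (A '' X = A '' (X ∪ Y) ∧ completeCount A X = ⊤) ∨
      (A '' Y = A '' (X ∪ Y) ∧ completeCount A Y = ⊤) := by
  classical
  have key : ∀ Z ⊆ X ∪ Y, (∀ k : ℕ, ∃ F : Finset (Set R),
      ((∀ T ∈ F, IsComplete A (X ∪ Y) T) ∧ (F : Set (Set R)).PairwiseDisjoint id) ∧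
        k ≤ (F.filter (· ⊆ Z)).card) → A '' Z = A '' (X ∪ Y) ∧ completeCount A Z = ⊤ := by
    intro Z hZ hk
    have himage : A '' Z = A '' (X ∪ Y) := by
      obtain ⟨F, hF, h1⟩ := hk 1
      obtain ⟨T, hT⟩ := Finset.card_pos.1 h1
      rw [Finset.mem_filter] at hT
      exact (Set.image_mono hZ).antisymm ((hF.1 T hT.1).2 ▸ Set.image_mono hT.2)
    refine ⟨himage, completeCount_eq_top_iff.2 fun k => ?_⟩
    obtain ⟨F, hF, h1⟩ := hk k
    refine ⟨F.filter (· ⊆ Z), ⟨fun T hT => ?_,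
      hF.2.subset (Finset.coe_subset.2 (Finset.filter_subset _ _))⟩, h1⟩
    rw [Finset.mem_filter] at hT
    have hT' := hF.1 T hT.1
    exact ⟨⟨hT.2, fun a ha b hb g hg => hT'.1.2 a ha b hb g (hZ hg)⟩, hT'.2.trans himage.symm⟩
  by_contra hcon
  rw [not_or] at hcon
  have hX := mt (key X Set.subset_union_left) hcon.1
  have hY := mt (key Y Set.subset_union_right) hcon.2
  push Not at hX hY
  obtain ⟨k₁, hk₁⟩ := hX
  obtain ⟨k₂, hk₂⟩ := hY
  obtain ⟨F, hF, hk⟩ := completeCount_eq_top_iff.1 hS (k₁ + k₂ + 1)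
  have h₁ := hk₁ F hF
  have h₂ := hk₂ F hF
  -- Two intervals straddling the cut intersect: the larger of their chosen points in `X` belongs to
  -- both.
  have h₃ : (F.filter fun T => ¬ T ⊆ X ∧ ¬ T ⊆ Y).card ≤ 1 := by
    refine Finset.card_le_one.2 fun T hT T' hT' => ?_
    simp only [Finset.mem_filter, Set.not_subset] at hT hT'
    obtain ⟨hT, ⟨b, hb, hbX⟩, ⟨a, ha, haY⟩⟩ := hT
    obtain ⟨hT', ⟨b', hb', hbX'⟩, ⟨a', ha', haY'⟩⟩ := hT'
    have hc := hF.1 T hT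
    have hc' := hF.1 T' hT'
    have hbY := (hc.1.1 hb).resolve_left hbX
    have haX := (hc.1.1 ha).resolve_right haY
    have hbY' := (hc'.1.1 hb').resolve_left hbX'
    have haX' := (hc'.1.1 ha').resolve_right haY'
    by_contra hne
    have hdis : Disjoint T T' := hF.2 hT hT' hne
    rcases lt_trichotomy a a' with h1 | rfl | h1
    · exact Set.disjoint_left.1 hdis
        (hc.1.2 a ha b hb a' (Or.inl haX') h1 (h a' haX' b hbY)) ha'
    · exact Set.disjoint_left.1 hdis ha ha'
    · exact Set.disjoint_left.1 hdis ha
        (hc'.1.2 a' ha' b' hb' a (Or.inl haX) h1 (h a haX b' hbY'))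
  have hcover : F ⊆ F.filter (· ⊆ X) ∪ F.filter (· ⊆ Y) ∪
      F.filter fun T => ¬ T ⊆ X ∧ ¬ T ⊆ Y := by
    intro T hT
    simp only [Finset.mem_union, Finset.mem_filter]
    tauto
  have := (Finset.card_le_card hcover).trans (Finset.card_union_le _ _)
  have := Finset.card_union_le (F.filter (· ⊆ X)) (F.filter (· ⊆ Y))
  omega

/-- `X` is a finite ordered union of sets on each of which `A` omits a value from `V`. -/
def IsFinitelyDivisible (A : R → Mat n) (V : Set (Mat n)) (X : Set R) : Prop :=
  ∃ (k : ℕ) (T : Fin k → Set R), ⋃ i, T i = X ∧ (∀ i j, i < j → Precedes (T i) (T j)) ∧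
    ∀ i, A '' T i ≠ V

theorem IsFinitelyDivisible.of_ne {V : Set (Mat n)} (h : A '' X ≠ V) :
    IsFinitelyDivisible A V X :=
  ⟨1, fun _ => X, Set.iUnion_const X, fun i j hij => absurd hij (by simp [Subsingleton.elim i j]),
    fun _ => h⟩

theorem IsFinitelyDivisible.union {V : Set (Mat n)} (h : Precedes X Y)
    (hX : IsFinitelyDivisible A V X) (hY : IsFinitelyDivisible A V Y) :
    IsFinitelyDivisible A V (X ∪ Y) := by
  obtain ⟨k, T, hU, hT, hV⟩ := hX
  obtain ⟨k', T', hU', hT', hV'⟩ := hY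
  refine ⟨k + k', Fin.append T T', ?_, ?_, ?_⟩
  · rw [← hU, ← hU']
    ext x
    simp only [Set.mem_iUnion, Set.mem_union]
    constructor
    · rintro ⟨i, hi⟩
      induction i using Fin.addCases with
      | left i => exact Or.inl ⟨i, by simpa using hi⟩
      | right i => exact Or.inr ⟨i, by simpa using hi⟩
    · rintro (⟨i, hi⟩ | ⟨i, hi⟩)
      · exact ⟨Fin.castAdd k' i, by simpa using hi⟩
      · exact ⟨Fin.natAdd k i, by simpa using hi⟩
  · intro i j hij
    induction i using Fin.addCases with
    | left i =>
      induction j using Fin.addCases with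
      | left j =>
        simp only [Fin.append_left]
        exact hT i j (by rw [Fin.lt_def] at hij ⊢; simpa only [Fin.val_castAdd] using hij)
      | right j =>
        simp only [Fin.append_left, Fin.append_right]
        exact fun a ha b hb => h a (hU ▸ Set.mem_iUnion_of_mem i ha) b
          (hU' ▸ Set.mem_iUnion_of_mem j hb)
    | right i =>
      induction j using Fin.addCases with
      | left j =>
        simp only [Fin.lt_def, Fin.val_natAdd, Fin.val_castAdd] at hij
        omega
      | right j =>
        simp only [Fin.append_right]
        exact hT' i j (by
          rw [Fin.lt_def] at hij ⊢
          simpa only [Fin.val_natAdd, Nat.add_lt_add_iff_left] using hij)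
  · intro i
    induction i using Fin.addCases with
    | left i => simpa using hV i
    | right i => simpa using hV' i

/-- Choose one representative of each value and take the largest. -/
theorem exists_image_subset_le (hfin : (A '' S).Finite) (hne : S.Nonempty) :
    ∃ x ∈ S, A '' S ⊆ A '' {y ∈ S | y ≤ x} := by
  obtain ⟨t, htS, ht⟩ := Set.exists_subset_bijOn S A
  have htfin : t.Finite := Set.Finite.of_finite_image (ht.image_eq ▸ hfin) ht.injOn
  have htne : t.Nonempty := Set.image_nonempty.1 (ht.image_eq ▸ hne.image A)
  obtain ⟨x, hx, hmax⟩ := Set.exists_max_image t id htfin htne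
  refine ⟨x, htS hx, ?_⟩
  rw [← ht.image_eq]
  exact Set.image_mono fun y hy => ⟨htS hy, hmax y hy⟩

/-- The union of the lower sections of `S` on which `A` omits a value of `A '' S` omits one too. -/
theorem image_lower_ne (hfin : (A '' S).Finite) (hS : S.Nonempty) :
    A '' {x ∈ S | A '' {y ∈ S | y ≤ x} ≠ A '' S} ≠ A '' S := by
  set L := {x ∈ S | A '' {y ∈ S | y ≤ x} ≠ A '' S}
  have hLS : L ⊆ S := fun x hx => hx.1
  intro h
  obtain ⟨x, hx, hsub⟩ := exists_image_subset_le (A := A) (S := L) (h ▸ hfin)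
    (Set.image_nonempty.1 (h ▸ hS.image A))
  rw [h] at hsub
  exact hx.2 ((Set.image_mono fun y hy => hy.1).antisymm
    (hsub.trans (Set.image_mono fun y hy => ⟨hLS hy.1, hy.2⟩)))

/-- A set that is not finitely divisible can be cut into two complete parts, one of which is not
finitely divisible. -/
theorem exists_cut (hfin : (A '' S).Finite) (hA : (A '' S).Nontrivial)
    (hS : ¬ IsFinitelyDivisible A (A '' S) S) :
    ∃ X Y, Precedes X Y ∧ X ∪ Y = S ∧ A '' X = A '' S ∧ A '' Y = A '' S ∧
      (¬ IsFinitelyDivisible A (A '' S) X ∨ ¬ IsFinitelyDivisible A (A '' S) Y) := by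
  by_contra! hcon
  have hne : S.Nonempty := Set.image_nonempty.1 hA.nonempty
  apply hS
  -- At such an `x`, each open side is incomplete or belongs to a cut into complete parts, hence is
  -- divisible; `{x}` is incomplete as `A` is not constant. Without such an `x`, the points with
  -- incomplete lower section and the remaining points form two incomplete pieces.
  by_cases hmid : ∃ x ∈ S, A '' {y ∈ S | y ≤ x} = A '' S ∧ A '' {y ∈ S | x ≤ y} = A '' S
  · obtain ⟨x, hx, hle, hge⟩ := hmid
    have hlt : IsFinitelyDivisible A (A '' S) {y ∈ S | y < x} := by
      by_cases h : A '' {y ∈ S | y < x} = A '' S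
      · refine (hcon {y ∈ S | y < x} {y ∈ S | x ≤ y}
          (fun a ha b hb => ha.2.trans_le hb.2) ?_ h hge).1
        rw [← Set.sep_or]
        exact Set.sep_eq_self_iff_mem_true.2 fun y _ => lt_or_ge y x
      · exact .of_ne h
    have hgt : IsFinitelyDivisible A (A '' S) {y ∈ S | x < y} := by
      by_cases h : A '' {y ∈ S | x < y} = A '' S
      · refine (hcon {y ∈ S | y ≤ x} {y ∈ S | x < y}
          (fun a ha b hb => ha.2.trans_lt hb.2) ?_ hle h).2
        rw [← Set.sep_or]
        exact Set.sep_eq_self_iff_mem_true.2 fun y _ => le_or_gt y x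
      · exact .of_ne h
    have hsing : IsFinitelyDivisible A (A '' S) {x} := .of_ne fun h => by
      rw [← h, Set.image_singleton] at hA
      exact Set.not_nontrivial_singleton hA
    have hS' : {y ∈ S | y < x} ∪ ({x} ∪ {y ∈ S | x < y}) = S := by
      ext y
      simp only [Set.mem_union, Set.mem_ofPred_eq, Set.mem_singleton_iff]
      constructor
      · rintro (h | rfl | h)
        exacts [h.1, hx, h.1]
      · intro h
        rcases lt_trichotomy y x with h1 | h1 | h1
        exacts [.inl ⟨h, h1⟩, .inr (.inl h1), .inr (.inr ⟨h, h1⟩)]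
    have hun := IsFinitelyDivisible.union (X := {y ∈ S | y < x})
      (Y := {x} ∪ {y ∈ S | x < y}) ?_ hlt (.union ?_ hsing hgt)
    · rwa [hS'] at hun
    · rintro a ha b (rfl | hb)
      exacts [ha.2, ha.2.trans hb.2]
    · rintro a rfl b hb
      exact hb.2
  · push Not at hmid
    have hL := image_lower_ne hfin hne
    have hU : A '' {x ∈ S | A '' {y ∈ S | x ≤ y} ≠ A '' S} ≠ A '' S :=
      -- Upper sections are lower sections for the reversed order.
      image_lower_ne (R := Rᵒᵈ) (A := A) hfin hne
    set L := {x ∈ S | A '' {y ∈ S | y ≤ x} ≠ A '' S}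
    have hLS : L ∪ S \ L = S := Set.union_sdiff_cancel fun x hx => hx.1
    have hle : ∀ x ∈ S \ L, A '' {y ∈ S | y ≤ x} = A '' S := fun x hx =>
      by_contra fun h => hx.2 ⟨hx.1, h⟩
    have hun := IsFinitelyDivisible.union (X := L) (Y := S \ L) ?_ (.of_ne hL) (.of_ne ?_)
    · rwa [hLS] at hun
    · intro a ha b hb
      by_contra hab
      refine ha.2 ((Set.image_mono fun y hy => hy.1).antisymm ?_)
      rw [← hle b hb]
      exact Set.image_mono fun y hy => ⟨hy.1, hy.2.trans (not_lt.1 hab)⟩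
    · intro h
      refine hU ((Set.image_mono fun y hy => hy.1).antisymm ?_)
      conv_lhs => rw [← h]
      exact Set.image_mono fun x hx => ⟨hx.1, hmid x hx.1 (hle x hx)⟩

theorem exists_insert_complete {Z W : Set R} (hne : S.Nonempty) (hZ : IsComplete A S Z)
    (hW : IsComplete A S W) (hd : Disjoint Z W) {k : ℕ}
    (h : ∃ F : Finset (Set R), ((∀ T ∈ F, IsComplete A Z T) ∧
      (F : Set (Set R)).PairwiseDisjoint id) ∧ k ≤ F.card) :
    ∃ F : Finset (Set R), ((∀ T ∈ F, IsComplete A S T) ∧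
      (F : Set (Set R)).PairwiseDisjoint id) ∧ k + 1 ≤ F.card := by
  classical
  obtain ⟨F, ⟨hF, hdis⟩, hk⟩ := h
  have hWF : W ∉ F := fun hmem => by
    have hWne : W.Nonempty := Set.image_nonempty.1 (hW.2 ▸ hne.image A)
    exact hWne.ne_empty (disjoint_self.1 (hd.mono_left (hF W hmem).1.1))
  refine ⟨insert W F, ⟨?_, ?_⟩, by rw [Finset.card_insert_of_notMem hWF]; omega⟩
  · intro T hT
    rcases Finset.mem_insert.1 hT with rfl | hT
    exacts [hW, hZ.trans (hF T hT)]
  · rw [Finset.coe_insert]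
    exact hdis.insert fun T hT _ => (hd.mono_left (hF T hT).1.1).symm

/-- Each cut sets aside one complete part and continues in the indivisible one, which has the same
values. -/
theorem completeCount_eq_top_of_not_isFinitelyDivisible (hfin : (A '' S).Finite)
    (hA : (A '' S).Nontrivial) (hS : ¬ IsFinitelyDivisible A (A '' S) S) :
    completeCount A S = ⊤ := by
  rw [completeCount_eq_top_iff]
  intro k
  induction k generalizing S with
  | zero => exact ⟨∅, by simp, by simp⟩
  | succ k ih =>
    obtain ⟨X, Y, hXY, rfl, hX, hY, h⟩ := exists_cut hfin hA hS
    have hne : (X ∪ Y).Nonempty := Set.image_nonempty.1 hA.nonempty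
    have hd : Disjoint X Y := Set.disjoint_left.2 fun a ha hb => (hXY a ha a hb).false
    have hcX : IsComplete A (X ∪ Y) X := ⟨hXY.isIntervalOf_left, hX⟩
    have hcY : IsComplete A (X ∪ Y) Y := ⟨hXY.isIntervalOf_right, hY⟩
    rcases h with h | h
    · rw [← hX] at hfin hA h
      exact exists_insert_complete hne hcX hcY hd (ih hfin hA h)
    · rw [← hY] at hfin hA h
      exact exists_insert_complete hne hcY hcX hd.symm (ih hfin hA h)

end Count

/-! ### Continuous products -/

theorem ncard_image_mono {R : Type*} {A : R → Mat n} {X Y : Set R}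
    (hA : (Set.range A).Finite) (h : X ⊆ Y) :
    (A '' X).ncard ≤ (A '' Y).ncard :=
  Set.ncard_le_ncard (Set.image_mono h) (hA.subset (Set.image_subset_range A Y))

theorem ncard_image_lt {R : Type*} {A : R → Mat n} {X Y : Set R}
    (hA : (Set.range A).Finite) (h : X ⊆ Y) (hne : A '' X ≠ A '' Y) :
    (A '' X).ncard < (A '' Y).ncard :=
  Set.ncard_lt_ncard ((Set.image_mono h).ssubset_of_ne hne)
    (hA.subset (Set.image_subset_range A Y))

theorem isLowerSet_ncard_image_lt {R : Type*} {A : R → Mat n}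
    (hA : (Set.range A).Finite) (c : ℕ) :
    IsLowerSet {X : Set R | (A '' X).ncard < c} :=
  fun _ _ h hX => (ncard_image_mono hA h).trans_lt hX

section ContProd

variable {R : Type*} [LinearOrder R] {A : R → Mat n} {S X Y : Set R}

/-- The rules overlap on finite sets; partitions concatenate to the same ordered product, and the
projection rule cannot apply. -/
theorem IsContProd.exists_list {M : Mat n} (h : IsContProd A S M) (hS : S.Finite) :
    ∃ l : List R, l.Pairwise (· < ·) ∧ {r | r ∈ l} = S ∧ M = (l.map A).prod := by
  induction h with
  | finite l hl => exact ⟨l, hl, rfl, rfl⟩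
  | partition S _ k T hU hT _ P _ ih =>
    choose l hl hlT hP using fun i => ih i (hS.subset (hU ▸ Set.subset_iUnion T i))
    refine ⟨(List.ofFn l).flatten, ?_, ?_, ?_⟩
    · rw [List.pairwise_flatten, List.pairwise_ofFn]
      refine ⟨fun l' hl' => ?_, fun i j hij a ha b hb => ?_⟩
      · obtain ⟨i, rfl⟩ := List.mem_ofFn.1 hl'
        exact hl i
      · refine hT i j hij a ?_ b ?_
        · rw [← hlT i]; exact ha
        · rw [← hlT j]; exact hb
    · rw [← hU]
      ext x
      simp only [← hlT, Set.mem_ofPred_eq, List.mem_flatten, List.mem_ofFn, Set.mem_iUnion]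
      constructor
      · rintro ⟨_, ⟨i, rfl⟩, hx⟩
        exact ⟨i, hx⟩
      · rintro ⟨i, hx⟩
        exact ⟨l i, ⟨i, rfl⟩, hx⟩
    · rw [List.map_flatten, List.prod_flatten, List.map_map, List.map_ofFn]
      congr 2
      funext i
      exact hP i
  | projection S htop => exact absurd htop (completeCount_lt_top_of_finite hS).ne

theorem existsUnique_of_finite (hS : S.Finite) : ∃! M, IsContProd A S M := by
  set l := hS.toFinset.sort (· ≤ ·)
  have hl : l.Pairwise (· < ·) := (Finset.sortedLT_sort _).pairwise
  have hlS : {r | r ∈ l} = S := by ext; simp [l]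
  refine ⟨(l.map A).prod, by simpa only [hlS] using IsContProd.finite (A := A) l hl, ?_⟩
  intro M hM
  obtain ⟨l', hl', hlS', rfl⟩ := hM.exists_list hS
  rw [hl'.eq_of_mem_iff hl fun a => ?_]
  exact Set.ext_iff.1 (hlS'.trans hlS.symm) a

theorem IsContProd.isProjectionFor {M : Mat n} (h : IsContProd A S M)
    (hS : completeCount A S = ⊤) : IsProjectionFor (A '' S) M := by
  cases h with
  | finite l => exact absurd hS (completeCount_lt_top_of_finite l.finite_toSet).ne
  | partition _ hlt => exact absurd hS hlt.ne
  | projection _ _ _ hP => exact hP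

/-- Outside the finite and the projection case, a continuous product comes from a partition. -/
theorem IsContProd.exists_partition {M : Mat n} (h : IsContProd A S M) (hfin : S.Infinite)
    (hS : completeCount A S ≠ ⊤) : ∃ (k : ℕ) (T : Fin k → Set R) (P : Fin k → Mat n),
      ⋃ i, T i = S ∧ (∀ i j, i < j → Precedes (T i) (T j)) ∧ (∀ i, A '' T i ≠ A '' S) ∧
        (∀ i, IsContProd A (T i) (P i)) ∧ M = (List.ofFn P).prod := by
  cases h with
  | finite l => exact absurd l.finite_toSet hfin
  | partition _ _ k T hU hT hA P hP => exact ⟨k, T, P, hU, hT, hA, hP, rfl⟩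
  | projection _ htop => exact absurd htop hS

/-- The semigroup is that of `A '' S`, not of `Γ`: absorption by the projection for `A '' S` needs
this sharper form. -/
theorem IsContProd.mem_closedSemigroup {Γ : Set (Mat n)} (hcount : Γ.Countable)
    (hΓ : IsCP Γ) (hA : ∀ r, A r ∈ Γ) {M : Mat n} (h : IsContProd A S M) :
    M ∈ closedSemigroup (A '' S) := by
  induction h with
  | finite l =>
    refine Submonoid.list_prod_mem _ fun B hB => ?_
    obtain ⟨r, hr, rfl⟩ := List.mem_map.1 hB
    exact ContProd.mem_closedSemigroup ⟨r, hr, rfl⟩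
  | partition S _ k T hU _ _ P _ ih =>
    refine Submonoid.list_prod_mem _ fun B hB => ?_
    obtain ⟨i, rfl⟩ := List.mem_ofFn.1 hB
    exact closedSemigroup_mono (Set.image_mono (hU ▸ Set.subset_iUnion T i)) (ih i)
  | projection S _ P hP =>
    have hSΓ : A '' S ⊆ Γ := by rintro _ ⟨r, -, rfl⟩; exact hA r
    obtain ⟨Q, hQ, hQP⟩ := exists_isProjectionFor (hcount.mono hSΓ)
      fun B hB => hΓ.lcp B fun i => hSΓ (hB i)
    rwa [hP.unique (hΓ.transversal _ hSΓ) hQP]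

/-- Existence, uniqueness and multiplicativity under cuts of the continuous products over sets
on which `A` takes fewer than `c` values. -/
structure IsDeterminedBelow (A : R → Mat n) (c : ℕ) : Prop where
  existsUnique : ∀ S : Set R, (A '' S).ncard < c → ∃! M, IsContProd A S M
  union : ∀ X Y : Set R, Precedes X Y → (A '' (X ∪ Y)).ncard < c → ∀ M N : Mat n,
    IsContProd A X M → IsContProd A Y N → IsContProd A (X ∪ Y) (M * N)

/-- The continuous product of `A` over `S` (arbitrary if it is not determined). -/
noncomputable def contProd (A : R → Mat n) (S : Set R) : Mat n :=
  Classical.epsilon (IsContProd A S)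

theorem IsDeterminedBelow.contProd_spec {c : ℕ} (h : IsDeterminedBelow A c)
    (hS : (A '' S).ncard < c) : IsContProd A S (contProd A S) :=
  Classical.epsilon_spec (h.existsUnique S hS).exists

theorem IsDeterminedBelow.eq_contProd {c : ℕ} (h : IsDeterminedBelow A c)
    (hS : (A '' S).ncard < c) {M : Mat n} (hM : IsContProd A S M) : M = contProd A S :=
  (h.existsUnique S hS).unique hM (h.contProd_spec hS)

theorem isContProd_empty : IsContProd A ∅ 1 := by
  simpa using IsContProd.finite (A := A) [] List.Pairwise.nil

theorem IsDeterminedBelow.isAdditiveOn (hA : (Set.range A).Finite) {c : ℕ}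
    (h : IsDeterminedBelow A c) : IsAdditiveOn {X | (A '' X).ncard < c} (contProd A) where
  empty := ((existsUnique_of_finite Set.finite_empty).unique isContProd_empty
    (Classical.epsilon_spec ⟨1, isContProd_empty⟩)).symm
  union X Y hXY hc := (h.eq_contProd hc (h.union X Y hXY hc _ _
    (h.contProd_spec ((ncard_image_mono hA Set.subset_union_left).trans_lt hc))
    (h.contProd_spec ((ncard_image_mono hA Set.subset_union_right).trans_lt hc)))).symm

theorem IsDeterminedBelow.existsUnique_of_ncard_eq {Γ : Set (Mat n)} (hfin : Γ.Finite)
    (hΓ : IsCP Γ) (hAΓ : ∀ r, A r ∈ Γ) {c : ℕ} (h : IsDeterminedBelow A c)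
    (hc : (A '' S).ncard = c) : ∃! M, IsContProd A S M := by
  have hrange : Set.range A ⊆ Γ := Set.range_subset_iff.2 hAΓ
  have hA := hfin.subset hrange
  have hSΓ : A '' S ⊆ Γ := (Set.image_subset_range A S).trans hrange
  rcases S.finite_or_infinite with hS | hS
  · exact existsUnique_of_finite hS
  by_cases htop : completeCount A S = ⊤
  · obtain ⟨P, -, hP⟩ := exists_isProjectionFor (hfin.subset hSΓ).countable
      fun B hB => hΓ.lcp B fun i => hSΓ (hB i)
    exact ⟨P, .projection S htop P hP, fun M hM =>
      (hM.isProjectionFor htop).unique (hΓ.transversal _ hSΓ) hP⟩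
  have hlt : ∀ {k : ℕ} {T : Fin k → Set R}, ⋃ i, T i = S → (∀ i, A '' T i ≠ A '' S) →
      ∀ i, (A '' T i).ncard < c := fun hU hT i =>
    hc ▸ ncard_image_lt hA (hU ▸ Set.subset_iUnion _ i) (hT i)
  -- The constant case is separate because a singleton is then complete and cannot serve as a piece.
  have hnt : (A '' S).Nontrivial := by
    by_contra hcon
    exact htop (completeCount_eq_top_of_infinite hS (Set.not_nontrivial_iff.1 hcon))
  obtain ⟨k, T, hU, hT, hne⟩ : IsFinitelyDivisible A (A '' S) S :=
    by_contra fun hdiv => htop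
      (completeCount_eq_top_of_not_isFinitelyDivisible (hfin.subset hSΓ) hnt hdiv)
  refine ⟨_, .partition S (lt_top_iff_ne_top.2 htop) k T hU hT hne (fun i => contProd A (T i))
    fun i => h.contProd_spec (hlt hU hne i), fun M hM => ?_⟩
  obtain ⟨k', T', P, hU', hT', hne', hP, rfl⟩ := hM.exists_partition hS htop
  rw [(h.isAdditiveOn hA).prod_eq_prod (isLowerSet_ncard_image_lt hA c) hT hT' (hlt hU hne)
    (hlt hU' hne') (hU.trans hU'.symm)]
  congr 2
  funext i
  exact h.eq_contProd (hlt hU' hne' i) (hP i)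

theorem IsContProd.union_of_finite (hXY : Precedes X Y) (hS : (X ∪ Y).Finite) {M N : Mat n}
    (hM : IsContProd A X M) (hN : IsContProd A Y N) : IsContProd A (X ∪ Y) (M * N) := by
  obtain ⟨l, hl, rfl, rfl⟩ := hM.exists_list (hS.subset Set.subset_union_left)
  obtain ⟨l', hl', rfl, rfl⟩ := hN.exists_list (hS.subset Set.subset_union_right)
  have := IsContProd.finite (A := A) (l ++ l')
    (List.pairwise_append.2 ⟨hl, hl', fun a ha b hb => hXY a ha b hb⟩)
  rw [List.map_append, List.prod_append] at this
  convert this using 1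
  ext r
  simp

/-- A part `Z` of `S` over which the continuous product is the value of a partition of `S`. -/
theorem IsDeterminedBelow.eq_partitionValue {Γ : Set (Mat n)} (hfin : Γ.Finite)
    (hΓ : IsCP Γ) (hAΓ : ∀ r, A r ∈ Γ) {c : ℕ} (h : IsDeterminedBelow A c)
    (hc : (A '' S).ncard = c) (htop : completeCount A S ≠ ⊤) {k : ℕ} {T : Fin k → Set R}
    (hU : ⋃ i, T i = S) (hT : ∀ i j, i < j → Precedes (T i) (T j))
    (hne : ∀ i, A '' T i ≠ A '' S) {Z : Set R} (hZ : IsIntervalOf S Z) {M : Mat n}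
    (hM : IsContProd A Z M) : M = partitionValue (contProd A) T Z := by
  have hA := hfin.subset (Set.range_subset_iff.2 hAΓ)
  by_cases hZS : A '' Z = A '' S
  · refine (h.existsUnique_of_ncard_eq hfin hΓ hAΓ (hZS ▸ hc)).unique hM ?_
    have hlt : completeCount A Z < ⊤ :=
      (IsComplete.completeCount_le ⟨hZ, hZS⟩).trans_lt (lt_top_iff_ne_top.2 htop)
    have hTS : ∀ i, T i ⊆ S := fun i => hU ▸ Set.subset_iUnion T i
    -- The traces `T i ∩ Z` form an admissible partition of the complete interval `Z`, whose count
    -- is also finite.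
    have hTZ : ∀ i, A '' (T i ∩ Z) ≠ A '' S := fun i hi => hne i
      ((Set.image_mono (hTS i)).antisymm (hi ▸ Set.image_mono Set.inter_subset_left))
    refine .partition Z hlt k (fun i => T i ∩ Z) ?_ ?_ ?_ _ fun i => h.contProd_spec ?_
    · rw [← Set.iUnion_inter, hU, Set.inter_eq_right.2 hZ.1]
    · exact fun i j hij a ha b hb => hT i j hij a ha.1 b hb.1
    · exact fun i => hZS ▸ hTZ i
    · exact hc ▸ ncard_image_lt hA (Set.inter_subset_left.trans (hTS i)) (hTZ i)
  · have hlt : (A '' Z).ncard < c := hc ▸ ncard_image_lt hA hZ.1 hZS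
    rw [(h.isAdditiveOn hA).partitionValue_eq (isLowerSet_ncard_image_lt hA c) hT hlt
      (hU ▸ hZ.1)]
    exact h.eq_contProd hlt hM

theorem IsDeterminedBelow.union_of_ncard_eq {Γ : Set (Mat n)} (hfin : Γ.Finite)
    (hΓ : IsCP Γ) (hAΓ : ∀ r, A r ∈ Γ) {c : ℕ} (h : IsDeterminedBelow A c)
    (hXY : Precedes X Y) (hc : (A '' (X ∪ Y)).ncard = c) {M N : Mat n}
    (hM : IsContProd A X M) (hN : IsContProd A Y N) : IsContProd A (X ∪ Y) (M * N) := by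
  have hrange : Set.range A ⊆ Γ := Set.range_subset_iff.2 hAΓ
  have hA := hfin.subset hrange
  rcases (X ∪ Y).finite_or_infinite with hS | hS
  · exact hM.union_of_finite hXY hS hN
  by_cases htop : completeCount A (X ∪ Y) = ⊤
  · have htr := hΓ.transversal _ ((Set.image_subset_range A (X ∪ Y)).trans hrange)
    have hMc := closedSemigroup_mono (Set.image_mono (f := A) (Set.subset_union_left (t := Y)))
      (hM.mem_closedSemigroup hfin.countable hΓ hAΓ)
    have hNc := closedSemigroup_mono (Set.image_mono (f := A) (Set.subset_union_right (s := X)))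
      (hN.mem_closedSemigroup hfin.countable hΓ hAΓ)
    refine .projection _ htop _ ?_
    rcases hXY.completeCount_eq_top htop with ⟨hX, hXt⟩ | ⟨hY, hYt⟩
    · have hP := hM.isProjectionFor hXt
      rw [hX] at hP
      rwa [hP.mul_eq htr hNc]
    · have hP := hN.isProjectionFor hYt
      rw [hY] at hP
      rwa [hP.eq_mul hMc]
  -- One partition of `X ∪ Y` evaluates `X`, `Y` and their union, reducing the cut rule to
  -- multiplicativity of `partitionValue`.
  obtain ⟨L, hL, -⟩ := h.existsUnique_of_ncard_eq hfin hΓ hAΓ hc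
  obtain ⟨k, T, P, hU, hT, hne, -, -⟩ := hL.exists_partition hS htop
  have heq : ∀ {Z : Set R} {M : Mat n}, IsIntervalOf (X ∪ Y) Z → IsContProd A Z M →
      M = partitionValue (contProd A) T Z := fun hZ hM =>
    h.eq_partitionValue hfin hΓ hAΓ hc htop hU hT hne hZ hM
  have hadd := (h.isAdditiveOn hA).partitionValue (isLowerSet_ncard_image_lt hA c) hT
    fun i => hc ▸ ncard_image_lt hA (hU ▸ Set.subset_iUnion T i) (hne i)
  rwa [heq hXY.isIntervalOf_left hM, heq hXY.isIntervalOf_right hN,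
    ← hadd.union X Y hXY (Set.mem_univ _), ← heq ⟨subset_rfl, fun _ _ _ _ _ hg _ _ => hg⟩ hL]

theorem isDeterminedBelow {Γ : Set (Mat n)} (hfin : Γ.Finite) (hΓ : IsCP Γ)
    (hAΓ : ∀ r, A r ∈ Γ) (c : ℕ) : IsDeterminedBelow A c := by
  induction c with
  | zero => exact ⟨fun _ h => absurd h (Nat.not_lt_zero _),
      fun _ _ _ h => absurd h (Nat.not_lt_zero _)⟩
  | succ c ih =>
    refine ⟨fun S hS => ?_, fun X Y hXY hS M N hM hN => ?_⟩
    · rcases Nat.lt_succ_iff_lt_or_eq.1 hS with hS | hS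
      · exact ih.existsUnique S hS
      · exact ih.existsUnique_of_ncard_eq hfin hΓ hAΓ hS
    · rcases Nat.lt_succ_iff_lt_or_eq.1 hS with hS | hS
      · exact ih.union X Y hXY hS M N hM hN
      · exact ih.union_of_ncard_eq hfin hΓ hAΓ hXY hS hM hN

end ContProd

theorem exists_seq_semigroup {Γ : Set (Mat n)} {M : Mat n} (h : M ∈ closedSemigroup Γ) :
    ∃ u : ℕ → Mat n, (∀ i, u i ∈ semigroup Γ) ∧ Tendsto u atTop (𝓝 M) := by
  rw [semigroup_eq_closure]
  have : FirstCountableTopology (Mat n) :=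
    inferInstanceAs (FirstCountableTopology (Fin n → Fin n → ℝ))
  exact mem_closure_iff_seq_limit.1 h

end ContProd

theorem theorem4p3 {n : ℕ} (Γ : Set (ContProd.Mat n)) (hfin : Γ.Finite) (hCP : ContProd.IsCP Γ)
    {R : Type*} [LinearOrder R] (A : R → ContProd.Mat n) (hA : ∀ r, A r ∈ Γ) (S : Set R) :
    (∃! M : ContProd.Mat n, ContProd.IsContProd A S M) ∧
      ∀ M : ContProd.Mat n, ContProd.IsContProd A S M →
        ∃ u : ℕ → ContProd.Mat n,
          (∀ i, u i ∈ ContProd.semigroup Γ) ∧ Tendsto u atTop (𝓝 M) := by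
  -- The bound is instantiated as `(A '' S).ncard + 1`.
  refine ⟨(ContProd.isDeterminedBelow hfin hCP hA _).existsUnique S (Nat.lt_succ_self _),
    fun M hM => ContProd.exists_seq_semigroup ?_⟩
  refine ContProd.closedSemigroup_mono ?_ (hM.mem_closedSemigroup hfin.countable hCP hA)
  rintro _ ⟨r, -, rfl⟩
  exact hA r
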